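/- Let $N\ge 1$, let $\Omega\subset\mathbb R^N$ be a bounded open set, let $\tau,r>0$ and $a,b\ge 0$, and let $f:[0,\tau]\times\mathbb R^3\to\mathbb R$ be such that $f(t,\cdot,\cdot,\cdot)$ is Borel measurable for every $t\in[0,\tau]$ and $$|f(t,y,v,u)|\le a\sqrt{|y|^2+|v|^2}+b\qquad\text{for all } t\in[0,\tau],\ y,v,u\in\mathbb R.$$ Let $\mathcal X=\mathcal U=L^2(\Omega)$ (real-valued), and let $\mathcal A=-\Delta$ be the Dirichlet Laplacian in $\mathcal X$: $w\in D(\mathcal A)$ and $\mathcal A w=h$ if and only if $w\in H^1_0(\Omega)$, $h\in L^2(\Omega)$ and $\int_\Omega\nabla w\cdot\nabla\varphi\,dx=\int_\Omega h\varphi\,dx$ for all $\varphi\in C_c^\infty(\Omega)$. Let $\mathcal X^1=D(\mathcal A)$ with the norm $\|w\|_1=\|\mathcal A w\|_{L^2(\Omega)}$, and let $\mathcal Z^1=\mathcal X^1\times\mathcal X$ with the norm $\|(w,v)\|_{\mathcal Z^1}^2=\|w\|_1^2+\|v\|_{L^2(\Omega)}^2$. For $t\in[0,\tau]$, $\Phi=(\phi_1,\phi_2)\in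 C([-r,0];\mathcal Z^1)$ and $u\in\mathcal U$ put $$\mathbb F(t,\Phi,u)=\begin{pmatrix}0\\ f\big(t,\phi_1(-r)(\cdot),\phi_2(-r)(\cdot),u(\cdot)\big)\end{pmatrix}\in\mathcal Z^1 .$$ Then there exist constants $\tilde a,\tilde b>0$ such that, for all $(t,\Phi,u)\in[0,\tau]\times C([-r,0];\mathcal Z^1)\times\mathcal U$, $$\|\mathbb F(t,\Phi,u)\|_{\mathcal Z^1}\le\tilde a\,\|\Phi(-r)\|_{\mathcal Z^1}+\tilde b .$$ -/

import Mathlib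

open MeasureTheory TopologicalSpace
open scoped ContDiff Gradient Distributions InnerProductSpace

namespace Beam

noncomputable section

/-- The Euclidean space `ℝ^N`. -/
abbrev Eucl (N : ℕ) : Type := EuclideanSpace ℝ (Fin N)

/-- Lebesgue measure on the open set `Ω`. -/
abbrev vol {N : ℕ} (Ω : Opens (Eucl N)) : Measure (Eucl N) :=
  volume.restrict (Ω : Set (Eucl N))

/-- The real Hilbert space `𝒳 = L²(Ω)`; it is also the control space `𝒰`. -/
abbrev X {N : ℕ} (Ω : Opens (Eucl N)) : Type := Lp ℝ 2 (vol Ω)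

/-- The Hilbert space `L²(Ω; ℝ^N)` of vector fields (where gradients live). -/
abbrev XVec {N : ℕ} (Ω : Opens (Eucl N)) : Type := Lp (Eucl N) 2 (vol Ω)

section Laplacian

variable {N : ℕ} (Ω : Opens (Eucl N))

theorem testFunction_hasGradientAt (φ : 𝓓(Ω, ℝ)) (x : Eucl N) :
    HasGradientAt (φ : Eucl N → ℝ) (∇ (φ : Eucl N → ℝ) x) x :=
  ((φ.contDiff.differentiable (by simp)) x).hasGradientAt

/-- The classes in `L²(Ω) × L²(Ω; ℝ^N)` of the pairs `(φ, ∇φ)`, `φ ∈ C_c^∞(Ω)`. -/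
def testGradients : Submodule ℝ (X Ω × XVec Ω) where
  carrier := {p | ∃ φ : 𝓓(Ω, ℝ),
    (p.1 =ᵐ[vol Ω] fun x => φ x) ∧ (p.2 =ᵐ[vol Ω] fun x => ∇ (φ : Eucl N → ℝ) x)}
  zero_mem' := by
    refine ⟨0, ?_, ?_⟩
    · filter_upwards [Lp.coeFn_zero ℝ 2 (vol Ω)] with x hx
      simpa using hx
    · filter_upwards [Lp.coeFn_zero (Eucl N) 2 (vol Ω)] with x hx
      have h0 : ((0 : 𝓓(Ω, ℝ)) : Eucl N → ℝ) = fun _ => (0 : ℝ) := by ext; simp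
      rw [h0, gradient_fun_const]
      simpa using hx
  add_mem' := by
    rintro p q ⟨φ, h1, h2⟩ ⟨ψ, h3, h4⟩
    refine ⟨φ + ψ, ?_, ?_⟩
    · filter_upwards [Lp.coeFn_add p.1 q.1, h1, h3] with x hx e1 e3
      exact hx.trans (by simp [e1, e3])
    · filter_upwards [Lp.coeFn_add p.2 q.2, h2, h4] with x hx e2 e4
      have hs : ((φ + ψ : 𝓓(Ω, ℝ)) : Eucl N → ℝ) = (φ : Eucl N → ℝ) + ψ := by ext; simp
      have := ((testFunction_hasGradientAt Ω φ x).hasFDerivAt.add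
        (testFunction_hasGradientAt Ω ψ x).hasFDerivAt)
      rw [← map_add] at this
      rw [hs, (hasGradientAt_iff_hasFDerivAt.2 this).gradient]
      exact hx.trans (by simp [e2, e4])
  smul_mem' := by
    rintro c p ⟨φ, h1, h2⟩
    refine ⟨c • φ, ?_, ?_⟩
    · filter_upwards [Lp.coeFn_smul c p.1, h1] with x hx e1
      simp [hx, e1]
    · filter_upwards [Lp.coeFn_smul c p.2, h2] with x hx e2
      have hs : ((c • φ : 𝓓(Ω, ℝ)) : Eucl N → ℝ) = c • (φ : Eucl N → ℝ) := by ext; simp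
      have := (testFunction_hasGradientAt Ω φ x).hasFDerivAt.const_smul c
      have h' : HasGradientAt (c • (φ : Eucl N → ℝ)) (c • ∇ (φ : Eucl N → ℝ) x) x := by
        rw [hasGradientAt_iff_hasFDerivAt]
        simpa using this
      rw [hs, h'.gradient]
      simp [hx, e2]

/-- The Sobolev space `H¹₀(Ω)`, the closure of `C_c^∞(Ω)` in the `H¹` norm, each `w ∈ H¹₀(Ω)` being
paired with its weak gradient: the closure of the pairs `(φ, ∇φ)` in `L²(Ω) × L²(Ω; ℝ^N)`. -/
def H10 : Submodule ℝ (X Ω × XVec Ω) := (testGradients Ω).topologicalClosure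

/-- The graph of `𝒜 = -Δ` with Dirichlet boundary condition: the pairs `(w, h)` with
`w ∈ H¹₀(Ω)`, `h ∈ L²(Ω)` and `-Δ w = h` weakly, that is,
`∫_Ω ∇w · ∇φ = ∫_Ω h φ` for all `φ ∈ C_c^∞(Ω)`. -/
def laplacianGraph : Submodule ℝ (X Ω × X Ω) where
  carrier := {p | ∃ g : XVec Ω, (p.1, g) ∈ H10 Ω ∧
    ∀ q ∈ testGradients Ω, ⟪g, q.2⟫_ℝ = ⟪p.2, q.1⟫_ℝ}
  zero_mem' := ⟨0, (H10 Ω).zero_mem, fun q _ => by simp⟩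
  add_mem' := by
    rintro p q ⟨g, hg, h1⟩ ⟨k, hk, h2⟩
    refine ⟨g + k, by simpa using (H10 Ω).add_mem hg hk, fun φ hφ => ?_⟩
    rw [inner_add_left, h1 φ hφ, h2 φ hφ, Prod.snd_add, inner_add_left]
  smul_mem' := by
    rintro c p ⟨g, hg, h1⟩
    refine ⟨c • g, by simpa using (H10 Ω).smul_mem c hg, fun φ hφ => ?_⟩
    rw [real_inner_smul_left, h1 φ hφ, Prod.smul_snd, real_inner_smul_left]

/-- Every test function occurs in `testGradients`. -/
theorem exists_mem_testGradients (φ : 𝓓(Ω, ℝ)) :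
    ∃ q ∈ testGradients Ω, q.1 =ᵐ[vol Ω] fun x => φ x := by
  have hc : Continuous (∇ (φ : Eucl N → ℝ)) :=
    (InnerProductSpace.toDual ℝ (Eucl N)).symm.continuous.comp
      (φ.contDiff.continuous_fderiv (by simp))
  have hs : HasCompactSupport (∇ (φ : Eucl N → ℝ)) :=
    (φ.hasCompactSupport.fderiv ℝ).comp_left
      (g := (InnerProductSpace.toDual ℝ (Eucl N)).symm) (map_zero _)
  have m1 : MemLp (φ : Eucl N → ℝ) 2 (vol Ω) :=
    φ.continuous.memLp_of_hasCompactSupport φ.hasCompactSupport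
  have m2 : MemLp (∇ (φ : Eucl N → ℝ)) 2 (vol Ω) := hc.memLp_of_hasCompactSupport hs
  exact ⟨(m1.toLp _, m2.toLp _), ⟨φ, m1.coeFn_toLp, m2.coeFn_toLp⟩, m1.coeFn_toLp⟩

/-- `𝒜 w` is determined by `w`, so `laplacianGraph` is the graph of an operator. -/
theorem laplacianGraph_functional (p : X Ω × X Ω) (hp : p ∈ laplacianGraph Ω) (h0 : p.1 = 0) :
    p.2 = 0 := by
  obtain ⟨g, hg, h⟩ := hp
  rw [h0] at hg
  have hcl : ∀ q ∈ H10 Ω, ⟪g, q.2⟫_ℝ = ⟪p.2, q.1⟫_ℝ := by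
    have hc : IsClosed {q : X Ω × XVec Ω | ⟪g, q.2⟫_ℝ = ⟪p.2, q.1⟫_ℝ} :=
      isClosed_eq (by fun_prop) (by fun_prop)
    exact fun q hq => closure_minimal h hc hq
  have hg0 : g = 0 := by simpa using hcl _ hg
  have hL : MemLp (p.2 : Eucl N → ℝ) 2 (vol Ω) := Lp.memLp p.2
  have hz : ∀ᵐ x ∂volume, x ∈ (Ω : Set (Eucl N)) → p.2 x = 0 := by
    refine Ω.isOpen.ae_eq_zero_of_integral_contDiff_smul_eq_zero
      (locallyIntegrableOn_of_locallyIntegrable_restrict (hL.locallyIntegrable (by norm_num))) ?_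
    intro k hk hks hkΩ
    obtain ⟨q, hq, hqk⟩ := exists_mem_testGradients Ω ⟨k, hk, hks, hkΩ⟩
    have h1 := h q hq
    rw [hg0, inner_zero_left, L2.inner_def] at h1
    have hsupp : Function.support (fun x => k x • p.2 x) ⊆ Ω := fun x hx =>
      hkΩ (subset_tsupport _ (fun h' => hx (by simp [h'])))
    rw [← setIntegral_eq_integral_of_forall_compl_eq_zero
      (fun x hx => Function.notMem_support.1 fun h' => hx (hsupp h')), h1]
    refine integral_congr_ae ?_
    filter_upwards [hqk] with x hx
    rw [hx]
    simp
  refine Lp.ext ?_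
  filter_upwards [(ae_restrict_iff' Ω.isOpen.measurableSet).2 hz, Lp.coeFn_zero ℝ 2 (vol Ω)]
    with x hx h0
  rw [hx, h0, Pi.zero_apply]

/-- The operator `𝒜 = -Δ` in `L²(Ω)` with Dirichlet boundary condition. -/
def A : X Ω →ₗ.[ℝ] X Ω := (laplacianGraph Ω).toLinearPMap

/-- The space `𝒳¹ = D(𝒜)`. -/
def X1 : Type := (A Ω).domain

instance : AddCommGroup (X1 Ω) := inferInstanceAs (AddCommGroup (A Ω).domain)

instance : Module ℝ (X1 Ω) := inferInstanceAs (Module ℝ (A Ω).domain)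

/-- The inclusion `𝒳¹ ⊂ 𝒳`. -/
def X1.incl : X1 Ω →ₗ[ℝ] X Ω := (A Ω).domain.subtype

/-- The norm `‖w‖₁ = ‖𝒜 w‖` of `𝒳¹`. It is registered as a seminorm only because its definiteness
is a theorem about bounded `Ω` (and `N ≥ 1`) and not part of the definition. -/
instance : SeminormedAddCommGroup (X1 Ω) :=
  SeminormedAddCommGroup.induced (X1 Ω) (X Ω) (A Ω).toFun

theorem X1.norm_def (w : X1 Ω) : ‖w‖ = ‖(A Ω).toFun w‖ := rfl

/-- The space `𝒵¹ = 𝒳¹ × 𝒳`, with norm `‖(w, v)‖² = ‖w‖₁² + ‖v‖²`. -/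
abbrev Z1 : Type := WithLp 2 (X1 Ω × X Ω)

theorem Z1.norm_sq (z : Z1 Ω) : ‖z‖ ^ 2 = ‖z.fst‖ ^ 2 + ‖z.snd‖ ^ 2 :=
  WithLp.prod_norm_sq_eq_of_L2 z

end Laplacian

section Nonlinearity

variable {N : ℕ} {Ω : Opens (Eucl N)} {τ a b : ℝ} {f : Set.Icc (0 : ℝ) τ → ℝ → ℝ → ℝ → ℝ}

/-- The function `x ↦ f(t, y(x), v(x), u(x))` is square integrable on `Ω`. -/
theorem memLp_superposition (hΩ : Bornology.IsBounded (Ω : Set (Eucl N)))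
    (hmeas : ∀ t, Measurable fun p : ℝ × ℝ × ℝ => f t p.1 p.2.1 p.2.2)
    (hgrowth : ∀ t y v u, |f t y v u| ≤ a * √(|y| ^ 2 + |v| ^ 2) + b)
    (t : Set.Icc (0 : ℝ) τ) (y v u : X Ω) :
    MemLp (fun x => f t (y x) (v x) (u x)) 2 (vol Ω) := by
  have : IsFiniteMeasure (vol Ω) :=
    isFiniteMeasure_restrict.2 hΩ.measure_lt_top.ne
  have hm : AEStronglyMeasurable (fun x => f t (y x) (v x) (u x)) (vol Ω) :=
    ((hmeas t).comp ((Lp.stronglyMeasurable y).measurable.prodMk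
      ((Lp.stronglyMeasurable v).measurable.prodMk
        (Lp.stronglyMeasurable u).measurable))).aestronglyMeasurable
  have hb : MemLp (fun x => |a| * (|y x| + |v x|) + b) 2 (vol Ω) :=
    (((Lp.memLp y).abs.add (Lp.memLp v).abs).const_mul |a|).add (memLp_const b)
  refine hb.mono hm (Filter.Eventually.of_forall fun x => ?_)
  have h1 : √(|y x| ^ 2 + |v x| ^ 2) ≤ |y x| + |v x| :=
    Real.sqrt_le_iff.2 ⟨by positivity, by nlinarith [abs_nonneg (y x), abs_nonneg (v x)]⟩
  have h2 : a * √(|y x| ^ 2 + |v x| ^ 2) ≤ |a| * (|y x| + |v x|) :=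
    mul_le_mul (le_abs_self a) h1 (Real.sqrt_nonneg _) (abs_nonneg a)
  rw [Real.norm_eq_abs, Real.norm_eq_abs]
  exact ((hgrowth t _ _ _).trans (by linarith)).trans (le_abs_self _)

/-- The superposition operator `f^e(t, y, v, u) = f(t, y(·), v(·), u(·)) ∈ L²(Ω)`. -/
def fe (hΩ : Bornology.IsBounded (Ω : Set (Eucl N)))
    (hmeas : ∀ t, Measurable fun p : ℝ × ℝ × ℝ => f t p.1 p.2.1 p.2.2)
    (hgrowth : ∀ t y v u, |f t y v u| ≤ a * √(|y| ^ 2 + |v| ^ 2) + b)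
    (t : Set.Icc (0 : ℝ) τ) (y v u : X Ω) : X Ω :=
  (memLp_superposition hΩ hmeas hgrowth t y v u).toLp _

/-- The value `Φ(-r)` of a history `Φ ∈ C([-r, 0]; 𝒵¹)`. -/
def atDelay {r : ℝ} (hr : 0 < r) (Φ : C(Set.Icc (-r) 0, Z1 Ω)) : Z1 Ω :=
  Φ ⟨-r, le_refl _, by linarith⟩

/-- The abstract nonlinearity `𝔽(t, Φ, u) = (0, f^e(t, φ₁(-r), φ₂(-r), u)) ∈ 𝒵¹`, where
`Φ = (φ₁, φ₂) ∈ C([-r, 0]; 𝒵¹)` and `u ∈ 𝒰 = L²(Ω)`. -/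
def bbF (hΩ : Bornology.IsBounded (Ω : Set (Eucl N)))
    (hmeas : ∀ t, Measurable fun p : ℝ × ℝ × ℝ => f t p.1 p.2.1 p.2.2)
    (hgrowth : ∀ t y v u, |f t y v u| ≤ a * √(|y| ^ 2 + |v| ^ 2) + b)
    {r : ℝ} (hr : 0 < r)
    (t : Set.Icc (0 : ℝ) τ) (Φ : C(Set.Icc (-r) 0, Z1 Ω)) (u : X Ω) : Z1 Ω :=
  WithLp.toLp 2 (0,
    fe hΩ hmeas hgrowth t (X1.incl Ω (atDelay hr Φ).fst) (atDelay hr Φ).snd u)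

end Nonlinearity

end

end Beam

/-! The growth bound on `f` controls the superposition by the `L²` norms of `φ₁(-r)` and `φ₂(-r)`
plus a constant (`norm_fe_le`), but `𝒵¹` measures the first component by `‖𝒜 w‖`. What has to be
shown is therefore that `D(𝒜)` embeds boundedly in `L²(Ω)` (`norm_incl_le`). Testing `𝒜 w = h` with
`w` itself gives `‖∇w‖² ≤ ‖h‖ ‖w‖`, and the Poincaré inequality `‖w‖ ≤ 2R ‖∇w‖` on `H¹₀(Ω)`, with
`Ω` inside the ball of radius `R`, turns this into `‖w‖ ≤ (2R)² ‖h‖`. -/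

open Beam in
theorem poincare_testFunction {N : ℕ} (i : Fin N) (Ω : Opens (Eucl N)) {R : ℝ}
    (hR : ∀ x ∈ Ω, ‖x‖ ≤ R) (φ : 𝓓(Ω, ℝ)) :
    ∫ x in (Ω : Set (Eucl N)), φ x ^ 2 ≤
      4 * R ^ 2 * ∫ x in (Ω : Set (Eucl N)), ‖∇ (φ : Eucl N → ℝ) x‖ ^ 2 := by
  set e : Eucl N := EuclideanSpace.single i 1
  have hφc : Continuous φ := φ.continuous
  have hφs : HasCompactSupport φ := φ.hasCompactSupport
  have hgc : Continuous (∇ (φ : Eucl N → ℝ)) :=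
    (InnerProductSpace.toDual ℝ (Eucl N)).symm.continuous.comp
      (φ.contDiff.continuous_fderiv (by simp))
  have hgs : HasCompactSupport (∇ (φ : Eucl N → ℝ)) :=
    (φ.hasCompactSupport.fderiv ℝ).comp_left
      (g := (InnerProductSpace.toDual ℝ (Eucl N)).symm) (map_zero _)
  have hdφ (x : Eucl N) : HasFDerivAt (φ : Eucl N → ℝ)
      (InnerProductSpace.toDual ℝ (Eucl N) (∇ (φ : Eucl N → ℝ) x)) x :=
    (testFunction_hasGradientAt Ω φ x).hasFDerivAt
  have hd2 (x : Eucl N) : fderiv ℝ (fun y => φ y ^ 2) x e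
      = 2 * φ x * ⟪∇ (φ : Eucl N → ℝ) x, e⟫_ℝ := by
    rw [((hdφ x).pow 2).fderiv]
    simp
  have hdc (x : Eucl N) : fderiv ℝ (fun y : Eucl N => y i) x e = 1 := by
    have h : HasFDerivAt (fun y : Eucl N => y i)
        (EuclideanSpace.proj i : Eucl N →L[ℝ] ℝ) x :=
      (EuclideanSpace.proj i : Eucl N →L[ℝ] ℝ).hasFDerivAt
    rw [h.fderiv]
    simp [e]
  have hcoord : Continuous fun y : Eucl N => y i := by fun_prop
  have hsq : HasCompactSupport fun x => φ x ^ 2 :=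
    hφs.comp_left (g := fun t : ℝ => t ^ 2) (by simp)
  have hgsq : HasCompactSupport fun x => ‖∇ (φ : Eucl N → ℝ) x‖ ^ 2 :=
    hgs.comp_left (g := fun t : Eucl N => ‖t‖ ^ 2) (by simp)
  have hint2 : Integrable fun x => φ x ^ 2 :=
    Continuous.integrable_of_hasCompactSupport (by fun_prop) hsq
  have hintg : Integrable fun x => ‖∇ (φ : Eucl N → ℝ) x‖ ^ 2 :=
    Continuous.integrable_of_hasCompactSupport (by fun_prop) hgsq
  have hintd : Integrable fun x => 2 * φ x * ⟪∇ (φ : Eucl N → ℝ) x, e⟫_ℝ * x i := by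
    refine Continuous.integrable_of_hasCompactSupport (by fun_prop) ?_
    exact HasCompactSupport.mul_right (HasCompactSupport.mul_right
      (HasCompactSupport.mul_left hφs))
  have hintc : Integrable fun x => φ x ^ 2 * x i :=
    Continuous.integrable_of_hasCompactSupport (by fun_prop) (HasCompactSupport.mul_right hsq)
  -- Poincaré comes from writing `φ² = φ² ∂ᵢxᵢ` and integrating by parts. This is done on the whole
  -- space, where `φ` has compact support, so no regularity of `∂Ω` is needed.
  have hparts := integral_mul_fderiv_eq_neg_fderiv_mul_of_integrable (μ := volume) (v := e)
    (f := fun x => φ x ^ 2) (g := fun y : Eucl N => y i)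
    (by simpa only [hd2] using hintd)
    (by simpa only [hdc, mul_one] using hint2)
    hintc
    (fun x _ => ((hdφ x).pow 2).differentiableAt)
    (fun x _ => (EuclideanSpace.proj i : Eucl N →L[ℝ] ℝ).differentiableAt)
  simp only [hd2, hdc, mul_one] at hparts
  have hzero : ∀ x, x ∉ (Ω : Set (Eucl N)) → φ x = 0 := fun x hx =>
    image_eq_zero_of_notMem_tsupport fun h => hx (φ.tsupport_subset h)
  have hgrad (x : Eucl N) : |⟪∇ (φ : Eucl N → ℝ) x, e⟫_ℝ| ≤ ‖∇ (φ : Eucl N → ℝ) x‖ := by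
    simpa [e] using abs_real_inner_le_norm (∇ (φ : Eucl N → ℝ) x) e
  -- Young's inequality for `-2 φ (∂ᵢφ xᵢ)`, with `|xᵢ| ≤ R` on `Ω`; the weight `1/2` lets the `φ²`
  -- term be absorbed on the left, which doubles `2R²` to `4R²`.
  have hle : ∫ x in (Ω : Set (Eucl N)), φ x ^ 2 ≤ ∫ x in (Ω : Set (Eucl N)),
      ((1 / 2) * φ x ^ 2 + (2 * R ^ 2) * ‖∇ (φ : Eucl N → ℝ) x‖ ^ 2) := by
    calc ∫ x in (Ω : Set (Eucl N)), φ x ^ 2 = ∫ x, φ x ^ 2 :=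
          setIntegral_eq_integral_of_forall_compl_eq_zero fun x hx => by simp [hzero x hx]
      _ = ∫ x, -(2 * φ x * ⟪∇ (φ : Eucl N → ℝ) x, e⟫_ℝ * x i) := by
          rw [hparts, integral_neg]
      _ = ∫ x in (Ω : Set (Eucl N)), -(2 * φ x * ⟪∇ (φ : Eucl N → ℝ) x, e⟫_ℝ * x i) :=
          (setIntegral_eq_integral_of_forall_compl_eq_zero
            fun x hx => by simp [hzero x hx]).symm
      _ ≤ _ := by
          refine setIntegral_mono_on ?_ ?_ Ω.isOpen.measurableSet fun x hx => ?_
          · exact hintd.neg.integrableOn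
          · exact ((hint2.const_mul _).add (hintg.const_mul _)).integrableOn
          · have h1 : |⟪∇ (φ : Eucl N → ℝ) x, e⟫_ℝ * x i| ≤ ‖∇ (φ : Eucl N → ℝ) x‖ * R := by
              rw [abs_mul]
              exact mul_le_mul (hgrad x) ((PiLp.norm_apply_le x i).trans (hR x hx))
                (abs_nonneg _) (norm_nonneg _)
            have h2 := sq_le_sq.2 (h1.trans (le_abs_self _))
            nlinarith [sq_nonneg (φ x + 2 * (⟪∇ (φ : Eucl N → ℝ) x, e⟫_ℝ * x i))]
  rw [integral_add (hint2.const_mul _).integrableOn (hintg.const_mul _).integrableOn,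
    integral_const_mul, integral_const_mul] at hle
  linarith

open Beam in
theorem Lp_two_norm_sq {N : ℕ} {E : Type*} [NormedAddCommGroup E] [InnerProductSpace ℝ E]
    (Ω : Opens (Eucl N)) (g : Lp E 2 (vol Ω)) :
    ‖g‖ ^ 2 = ∫ x in (Ω : Set (Eucl N)), ‖g x‖ ^ 2 := by
  rw [← real_inner_self_eq_norm_sq, L2.inner_def]
  simp only [real_inner_self_eq_norm_sq]

open Beam in
/-- The Poincaré inequality on `H¹₀(Ω)` for bounded `Ω`. -/
theorem poincare_H10 {N : ℕ} (i : Fin N) (Ω : Opens (Eucl N)) {R : ℝ} (hR0 : 0 ≤ R)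
    (hR : ∀ x ∈ Ω, ‖x‖ ≤ R) (q : X Ω × XVec Ω) (hq : q ∈ H10 Ω) :
    ‖q.1‖ ≤ 2 * R * ‖q.2‖ := by
  -- The inequality is a closed condition on the pair, so it passes from test functions to the
  -- closure.
  have hc : IsClosed {q : X Ω × XVec Ω | ‖q.1‖ ≤ 2 * R * ‖q.2‖} :=
    isClosed_le (by fun_prop) (by fun_prop)
  refine closure_minimal ?_ hc hq
  rintro p ⟨φ, h1, h2⟩
  refine (sq_le_sq₀ (norm_nonneg _) (by positivity)).1 ?_
  have e1 : ‖p.1‖ ^ 2 = ∫ x in (Ω : Set (Eucl N)), φ x ^ 2 := by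
    rw [Lp_two_norm_sq]
    refine integral_congr_ae ?_
    filter_upwards [h1] with x hx
    rw [hx, Real.norm_eq_abs, sq_abs]
  have e2 : ‖p.2‖ ^ 2 = ∫ x in (Ω : Set (Eucl N)), ‖∇ (φ : Eucl N → ℝ) x‖ ^ 2 := by
    rw [Lp_two_norm_sq]
    refine integral_congr_ae ?_
    filter_upwards [h2] with x hx
    rw [hx]
  have := poincare_testFunction i Ω hR φ
  rw [mul_pow, e1, e2]
  linarith

theorem le_sq_mul_of_le_mul_of_sq_le {x y g C : ℝ} (hx : 0 ≤ x) (hy : 0 ≤ y)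
    (h : x ≤ C * g) (hg : g ^ 2 ≤ y * x) : x ≤ C ^ 2 * y := by
  rcases hx.eq_or_lt with rfl | h0
  · positivity
  · refine le_of_mul_le_mul_right ?_ h0
    calc x * x ≤ (C * g) * (C * g) := mul_self_le_mul_self hx h
      _ = C ^ 2 * g ^ 2 := by ring
      _ ≤ C ^ 2 * (y * x) := by gcongr
      _ = C ^ 2 * y * x := by ring

open Beam in
theorem norm_le_norm_laplacian {N : ℕ} (i : Fin N) (Ω : Opens (Eucl N)) {R : ℝ} (hR0 : 0 ≤ R)
    (hR : ∀ x ∈ Ω, ‖x‖ ≤ R) (p : X Ω × X Ω) (hp : p ∈ laplacianGraph Ω) :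
    ‖p.1‖ ≤ (2 * R) ^ 2 * ‖p.2‖ := by
  obtain ⟨g, hg, h⟩ := hp
  -- By continuity the weak equation holds against all of `H¹₀(Ω)`, so the solution itself may serve
  -- as test function.
  have hcl : ∀ q ∈ H10 Ω, ⟪g, q.2⟫_ℝ = ⟪p.2, q.1⟫_ℝ := by
    have hc : IsClosed {q : X Ω × XVec Ω | ⟪g, q.2⟫_ℝ = ⟪p.2, q.1⟫_ℝ} :=
      isClosed_eq (by fun_prop) (by fun_prop)
    exact fun q hq => closure_minimal h hc hq
  have h1 : ‖g‖ ^ 2 ≤ ‖p.2‖ * ‖p.1‖ := by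
    have h2 : ⟪g, g⟫_ℝ = ⟪p.2, p.1⟫_ℝ := hcl (p.1, g) hg
    exact (real_inner_self_eq_norm_sq g).symm.trans_le (h2.trans_le (real_inner_le_norm _ _))
  have h2 : ‖p.1‖ ≤ 2 * R * ‖g‖ := poincare_H10 i Ω hR0 hR (p.1, g) hg
  exact le_sq_mul_of_le_mul_of_sq_le (norm_nonneg _) (norm_nonneg _) h2 h1

open Beam in
/-- The embedding `𝒳¹ ⊂ 𝒳` is bounded. -/
theorem norm_incl_le {N : ℕ} (i : Fin N) (Ω : Opens (Eucl N)) {R : ℝ} (hR0 : 0 ≤ R)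
    (hR : ∀ x ∈ Ω, ‖x‖ ≤ R) (w : X1 Ω) : ‖X1.incl Ω w‖ ≤ (2 * R) ^ 2 * ‖w‖ := by
  refine norm_le_norm_laplacian i Ω hR0 hR (X1.incl Ω w, (A Ω).toFun w) ?_
  have h : (X1.incl Ω w, (A Ω).toFun w) ∈ (laplacianGraph Ω).toLinearPMap.graph :=
    LinearPMap.mem_graph (A Ω) w
  -- Single-valuedness is what identifies the graph of `A Ω` with `laplacianGraph Ω`.
  rwa [Submodule.toLinearPMap_graph_eq _ (laplacianGraph_functional Ω)] at h

-- Since `√(y² + v²) ≤ |y| + |v|`, the superposition is dominated a.e. by an element of the lattice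
-- `L²(Ω)`, and the norm is monotone. The constant `b` enters as the class `B`.
open Beam in
theorem norm_fe_le {N : ℕ} {Ω : Opens (Eucl N)} {τ a b : ℝ} (ha : 0 ≤ a)
    {f : Set.Icc (0 : ℝ) τ → ℝ → ℝ → ℝ → ℝ}
    (hΩ : Bornology.IsBounded (Ω : Set (Eucl N)))
    (hmeas : ∀ t, Measurable fun p : ℝ × ℝ × ℝ => f t p.1 p.2.1 p.2.2)
    (hgrowth : ∀ t y v u, |f t y v u| ≤ a * √(|y| ^ 2 + |v| ^ 2) + b)
    {B : X Ω} (hB : B =ᵐ[vol Ω] fun _ => b)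
    (t : Set.Icc (0 : ℝ) τ) (y v u : X Ω) :
    ‖fe hΩ hmeas hgrowth t y v u‖ ≤ a * (‖y‖ + ‖v‖) + ‖B‖ := by
  have hae : ∀ᵐ x ∂vol Ω, ‖fe hΩ hmeas hgrowth t y v u x‖
      ≤ ‖(a • (|y| + |v|) + B : X Ω) x‖ := by
    filter_upwards [(memLp_superposition hΩ hmeas hgrowth t y v u).coeFn_toLp,
      Lp.coeFn_add (a • (|y| + |v|)) B, Lp.coeFn_smul a (|y| + |v|), Lp.coeFn_add |y| |v|,
      Lp.coeFn_abs y, Lp.coeFn_abs v, hB] with x e0 e1 e2 e3 e4 e5 e6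
    have h1 : √(|y x| ^ 2 + |v x| ^ 2) ≤ |y x| + |v x| :=
      Real.sqrt_le_iff.2 ⟨by positivity, by nlinarith [abs_nonneg (y x), abs_nonneg (v x)]⟩
    rw [fe, e0, e1, Pi.add_apply, e2, Pi.smul_apply, e3, Pi.add_apply, e4, e5, e6, smul_eq_mul]
    exact ((hgrowth t _ _ _).trans (by gcongr)).trans (le_abs_self _)
  calc _ ≤ ‖a • (|y| + |v|) + B‖ := Lp.norm_le_norm_of_ae_le hae
    _ ≤ ‖a • (|y| + |v|)‖ + ‖B‖ := norm_add_le _ _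
    _ ≤ a * (‖y‖ + ‖v‖) + ‖B‖ := by
      rw [norm_smul, Real.norm_of_nonneg ha]
      gcongr
      simpa only [norm_abs_eq_norm] using norm_add_le |y| |v|

theorem proposition2p1 {N : ℕ} (hN : 1 ≤ N)
    (Ω : TopologicalSpace.Opens (EuclideanSpace ℝ (Fin N)))
    (hΩ : Bornology.IsBounded (Ω : Set (EuclideanSpace ℝ (Fin N))))
    (τ r : ℝ) (hτ : 0 < τ) (hr : 0 < r)
    (a b : ℝ) (ha : 0 ≤ a) (hb : 0 ≤ b)
    (f : Set.Icc (0 : ℝ) τ → ℝ → ℝ → ℝ → ℝ)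
    (hmeas : ∀ t, Measurable fun p : ℝ × ℝ × ℝ => f t p.1 p.2.1 p.2.2)
    (hgrowth : ∀ t y v u, |f t y v u| ≤ a * √(|y| ^ 2 + |v| ^ 2) + b) :
    ∃ a' b' : ℝ, 0 < a' ∧ 0 < b' ∧
      ∀ (t : Set.Icc (0 : ℝ) τ) (Φ : C(Set.Icc (-r) 0, Beam.Z1 Ω)) (u : Beam.X Ω),
        ‖Beam.bbF hΩ hmeas hgrowth hr t Φ u‖ ≤ a' * ‖Beam.atDelay hr Φ‖ + b' := by
  obtain ⟨R, hR0, hR⟩ := hΩ.exists_pos_norm_le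
  have hfin : IsFiniteMeasure (Beam.vol Ω) := isFiniteMeasure_restrict.2 hΩ.measure_lt_top.ne
  set B : Beam.X Ω := (memLp_const b).toLp _
  have hB : B =ᵐ[Beam.vol Ω] fun _ => b := (memLp_const b).coeFn_toLp
  -- The added `1`s only secure strict positivity, as `a` and `‖B‖` may vanish.
  refine ⟨a * ((2 * R) ^ 2 + 1) + 1, ‖B‖ + 1, by positivity, by positivity, fun t Φ u => ?_⟩
  set z := Beam.atDelay hr Φ
  have hz := Beam.Z1.norm_sq Ω z
  have h1 : ‖z.fst‖ ≤ ‖z‖ :=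
    (abs_le_of_sq_le_sq' (by nlinarith [sq_nonneg ‖z.snd‖]) (norm_nonneg _)).2
  have h2 : ‖z.snd‖ ≤ ‖z‖ :=
    (abs_le_of_sq_le_sq' (by nlinarith [sq_nonneg ‖z.fst‖]) (norm_nonneg _)).2
  -- `1 ≤ N` provides the coordinate direction used for Poincaré.
  have h3 := norm_incl_le ⟨0, hN⟩ Ω hR0.le hR z.fst
  calc ‖Beam.bbF hΩ hmeas hgrowth hr t Φ u‖
      = ‖Beam.fe hΩ hmeas hgrowth t (Beam.X1.incl Ω z.fst) z.snd u‖ :=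
        WithLp.norm_toLp_snd 2 (Beam.X1 Ω) (Beam.X Ω) _
    _ ≤ a * (‖Beam.X1.incl Ω z.fst‖ + ‖z.snd‖) + ‖B‖ :=
        norm_fe_le ha hΩ hmeas hgrowth hB t _ _ u
    _ ≤ a * ((2 * R) ^ 2 * ‖z‖ + ‖z‖) + ‖B‖ := by
        gcongr
        exact h3.trans (by gcongr)
    _ ≤ _ := by nlinarith [norm_nonneg z]
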